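/- Let $\mu\in(0,1)$, $\alpha=\frac{1+\mu}{2\mu}$, $\delta=\frac{1-\mu}{2\mu}$, let $\nu\ge 0$ be an integer, and for $n=0,1,2,\ldots$ and $x,y>0$ put $$P_n(x)=(-1)^n(\nu+n)!\,n!\sum_{k=0}^n\frac{(\alpha^2-\delta^2)^{k+\frac12}}{\delta^k}\,\frac{(-n)_k}{(\nu+k)!\,k!}\,x^{\frac k2}I_k(2\delta\sqrt x),$$ $$Q_n(y)=(-1)^n\frac{2}{(n!)^2}\sum_{l=0}^n\frac{(\alpha^2-\delta^2)^{l+\nu+\frac12}}{\alpha^{l+\nu}}\,\frac{(-n)_l}{(\nu+l)!\,l!}\,y^{\frac{l+\nu}2}K_{l+\nu}(2\alpha\sqrt y),$$ where $I_\kappa$ and $K_\kappa$ are the modified Bessel functions of the first and second kind and $(a)_k=a(a+1)\cdots(a+k-1)$. (a) For every $n\ge 0$, every $x>0$ and every closed piecewise $C^1$ contour $\Sigma$ that encircles $0,1,\ldots,n$ once in the positive direction (that is, it avoids these points and has winding number $1$ about each of them), $$P_n(x)=\frac{(\nu+n)!\,(n!)^2}{2\pi i}(\alpha^2-\delta^2)^{\frac12}\oint_{\Sigma}\frac{\Gamma(t-n)\,(\alpha^2-\delta^2)^t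 x^t}{\Gamma(t+1)^2\,\Gamma(t+\nu+1)}\;{}_0F_1\!\left(-;t+1;\delta^2x\right)dt .$$ (b) For every $n\ge 0$, every $y>0$ and every $c>0$, $$Q_n(y)=\frac{1}{2\pi i\,(n!)^2(n+\nu)!}\left(1-\frac{\delta^2}{\alpha^2}\right)^{\nu}(\alpha^2-\delta^2)^{\frac12}\int_{c-i\infty}^{c+i\infty}\frac{\Gamma(s)^2\,\Gamma(s+\nu)}{\Gamma(s-n)}\;{}_2F_1\!\left(-n,\nu+s;s-n;\frac{\delta^2}{\alpha^2}\right)(\alpha^2y)^{-s}\,ds .$$ Both integrals converge absolutely (removable singularities of the integrands on the contours being disregarded). -/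

import Mathlib

noncomputable section

namespace DependentGaussian

/-- `α(μ) = (1 + μ) / (2 μ)`. -/
def α (μ : ℝ) : ℝ := (1 + μ) / (2 * μ)

/-- `δ(μ) = (1 - μ) / (2 μ)`. -/
def δ (μ : ℝ) : ℝ := (1 - μ) / (2 * μ)

/-- The modified Bessel function of the first kind `I_κ(z)`, for `z > 0` (and `κ ≥ 0`),
through its power series. -/
def besselI (κ z : ℝ) : ℝ :=
  ∑' m : ℕ, 1 / ((m.factorial : ℝ) * Real.Gamma (κ + m + 1)) * (z / 2) ^ (2 * (m : ℝ) + κ)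

/-- The modified Bessel function of the second kind `K_κ(z)`, for `z > 0`,
`K_κ(z) = ∫₀^∞ exp (-z cosh t) cosh (κ t) dt`. The integral converges absolutely for all
real `κ`, including `κ = 0`. -/
def besselK (κ z : ℝ) : ℝ :=
  ∫ t in Set.Ioi (0 : ℝ), Real.exp (-z * Real.cosh t) * Real.cosh (κ * t)

/-- The function `P_n(x)`; `(-n)_k` is the rising factorial. -/
def P (μ : ℝ) (ν n : ℕ) (x : ℝ) : ℝ :=
  (-1) ^ n * ((ν + n).factorial : ℝ) * (n.factorial : ℝ) *
    ∑ k ∈ Finset.range (n + 1),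
      (α μ ^ 2 - δ μ ^ 2) ^ ((k : ℝ) + 1 / 2) / δ μ ^ k *
        ((ascPochhammer ℝ k).eval (-(n : ℝ)) / (((ν + k).factorial : ℝ) * (k.factorial : ℝ))) *
        x ^ ((k : ℝ) / 2) * besselI k (2 * δ μ * Real.sqrt x)

/-- The function `Q_n(y)`; `(-n)_l` is the rising factorial. -/
def Q (μ : ℝ) (ν n : ℕ) (y : ℝ) : ℝ :=
  (-1) ^ n * (2 / (n.factorial : ℝ) ^ 2) *
    ∑ l ∈ Finset.range (n + 1),
      (α μ ^ 2 - δ μ ^ 2) ^ ((l : ℝ) + ν + 1 / 2) / α μ ^ (l + ν) *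
        ((ascPochhammer ℝ l).eval (-(n : ℝ)) / (((ν + l).factorial : ℝ) * (l.factorial : ℝ))) *
        y ^ (((l : ℝ) + ν) / 2) * besselK ((l : ℝ) + ν) (2 * α μ * Real.sqrt y)

/-- The confluent hypergeometric limit function `₀F₁(-; b; z) = ∑ z^k / ((b)_k k!)`. -/
def hypergeometric0F1 (b z : ℂ) : ℂ :=
  ∑' k : ℕ, z ^ k / ((ascPochhammer ℂ k).eval b * (k.factorial : ℂ))

/-- A path is piecewise `C¹`: finitely many points subdivide `[0, 1]` into closed intervals on
each of which the path is `C¹` (with one-sided derivatives at the endpoints). -/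
def IsPiecewiseC1 {a b : ℂ} (γ : Path a b) : Prop :=
  ∃ S : Finset ℝ, ∀ u v : ℝ, 0 ≤ u → u < v → v ≤ 1 → Disjoint (Set.Ioo u v) (S : Set ℝ) →
    ContDiffOn ℝ 1 γ.extend (Set.Icc u v)

/-- The complex 1-form `f(z) dz`. -/
def formDz (f : ℂ → ℂ) (z : ℂ) : ℂ →L[ℂ] ℂ := f z • ContinuousLinearMap.id ℂ ℂ

/-- The contour integral `∫_γ f(z) dz`. -/
def contourIntegral {a b : ℂ} (γ : Path a b) (f : ℂ → ℂ) : ℂ :=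
  curveIntegral (formDz f) γ

/-- The winding number `(1 / 2πi) ∫_γ dz / (z - w)` of a closed contour about `w`. -/
def windingNumber {a : ℂ} (γ : Path a a) (w : ℂ) : ℂ :=
  1 / (2 * Real.pi * Complex.I) * contourIntegral γ (fun z => 1 / (z - w))

/-- `γ` is a closed (piecewise `C¹`) contour that encircles `0, 1, …, n` once in the positive
direction: it avoids these points and has winding number `1` about each of them. -/
structure EncirclesOnce {a : ℂ} (γ : Path a a) (n : ℕ) : Prop where
  piecewiseC1 : IsPiecewiseC1 γ
  avoids : ∀ k : ℕ, k ≤ n → (k : ℂ) ∉ Set.range γ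
  winding : ∀ k : ℕ, k ≤ n → windingNumber γ (k : ℂ) = 1

/-- The integral `∫_{c - i∞}^{c + i∞} f(s) ds`. -/
def verticalIntegral (c : ℝ) (f : ℂ → ℂ) : ℂ :=
  Complex.I * ∫ τ : ℝ, f ((c : ℂ) + τ * Complex.I)

/-- The integrand of the representation of `P_n(x)`. -/
def integrandP (μ : ℝ) (ν n : ℕ) (x : ℝ) (t : ℂ) : ℂ :=
  Complex.Gamma (t - n) * ((α μ ^ 2 - δ μ ^ 2 : ℝ) : ℂ) ^ t * (x : ℂ) ^ t /
      (Complex.Gamma (t + 1) ^ 2 * Complex.Gamma (t + ν + 1)) *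
    hypergeometric0F1 (t + 1) ((δ μ ^ 2 * x : ℝ) : ℂ)

/-- The integrand of the representation of `Q_n(y)`. -/
def integrandQ (μ : ℝ) (ν n : ℕ) (y : ℝ) (s : ℂ) : ℂ :=
  Complex.Gamma s ^ 2 * Complex.Gamma (s + ν) / Complex.Gamma (s - n) *
    ordinaryHypergeometric (-(n : ℂ)) ((ν : ℂ) + s) (s - n) ((δ μ ^ 2 / α μ ^ 2 : ℝ) : ℂ) *
    ((α μ ^ 2 * y : ℝ) : ℂ) ^ (-s)

end DependentGaussian

end

open DependentGaussian

/-! Both integrands collapse to finite sums once the Gamma quotients are cancelled. (a) Off the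
integers `Γ(t-n)/Γ(t+1) = 1/∏_{j≤n} (t-j)`, and the other factor `1/Γ(t+1)` regularizes `₀F₁` to a
function entire in `t`. The integrand is therefore an entire `E(t)` over `t(t-1)⋯(t-n)`. Partial
fractions (`inv_prod_sub_natCast`) and Cauchy's formula for winding number 1 give a combination of
the values `E(k)`, and each `E(k)` contains the power series of `I_k`. (b) `Γ(s)/Γ(s-n) = (s-n)_n`
clears the denominators of the terminating `₂F₁`. The transformation `q ↦ 1 - q`
(`terminatingGaussSum_one_sub`) expands the result in `(s+ν)_l` with coefficients free of `s`, and
`Γ(s+ν)(s+ν)_l = Γ(s+l+ν)`. What remains is a combination of integrals of `Γ(s)Γ(s+κ)Y^{-s}` with `κ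
= l+ν` and `Y = α²y`, which Mellin inversion evaluates as multiples of `2Y^{κ/2}K_κ(2√Y)`. -/

open DependentGaussian
open MeasureTheory Set Filter Topology

/-! ### Terminating Gauss sums and Pochhammer identities -/

/-- The homogenized terminating Gauss sum
`∑_l C(n, l) (-q)^l (b)_l (d + l)_{n - l} = (d)_n ₂F₁(-n, b; d; q)`. -/
noncomputable def terminatingGaussSum (n : ℕ) (b d q : ℂ) : ℂ :=
  ∑ ij ∈ Finset.HasAntidiagonal.antidiagonal n, (n.choose ij.1 : ℂ) *
    ((-q) ^ ij.1 * (ascPochhammer ℂ ij.1).eval b * (ascPochhammer ℂ ij.2).eval (d + ij.1))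

theorem ascPochhammer_succ_eval_left (n : ℕ) (x : ℂ) :
    (ascPochhammer ℂ (n + 1)).eval x = x * (ascPochhammer ℂ n).eval (x + 1) := by
  simp [ascPochhammer_succ_left, Polynomial.eval_comp]

theorem ascPochhammer_add_eval (k m : ℕ) (x : ℂ) :
    (ascPochhammer ℂ (k + m)).eval x =
      (ascPochhammer ℂ k).eval x * (ascPochhammer ℂ m).eval (x + k) := by
  simp [← ascPochhammer_mul, Polynomial.eval_comp]

/-- Pascal's rule splits each term in two: one part releases the last factor `d + n` of the second
Pochhammer symbol, the other the first factor `b` of the first. -/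
theorem terminatingGaussSum_succ (n : ℕ) (b d q : ℂ) :
    terminatingGaussSum (n + 1) b d q =
      (d + n) * terminatingGaussSum n b d q -
        q * b * terminatingGaussSum n (b + 1) (d + 1) q := by
  simp only [terminatingGaussSum]
  rw [Finset.sum_antidiagonal_choose_succ_mul
    (fun i j => (-q) ^ i * (ascPochhammer ℂ i).eval b * (ascPochhammer ℂ j).eval (d + i)),
    Finset.mul_sum, Finset.mul_sum, sub_eq_add_neg, ← Finset.sum_neg_distrib]
  congr 1
  · refine Finset.sum_congr rfl fun ij hij => ?_
    have h : ((ij.1 : ℂ) + ij.2) = n := by exact_mod_cast Finset.HasAntidiagonal.mem_antidiagonal.mp hij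
    rw [ascPochhammer_succ_eval, ← h]
    ring
  · refine Finset.sum_congr rfl fun ij hij => ?_
    have h : n.choose ij.2 = n.choose ij.1 :=
      (Nat.choose_symm_of_eq_add (Finset.HasAntidiagonal.mem_antidiagonal.mp hij).symm).symm
    rw [ascPochhammer_succ_eval_left, h]
    push_cast
    rw [show d + ((ij.1 : ℂ) + 1) = d + 1 + ij.1 by ring]
    ring

/-- Holds term by term: after pulling out common factors the `l`-th term reads `(b + l) - (b - d) =
d + l`. -/
theorem terminatingGaussSum_contiguous (n : ℕ) (b d q : ℂ) :
    (d + n) * terminatingGaussSum n b d q =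
      b * terminatingGaussSum n (b + 1) (d + 1) q - (b - d) * terminatingGaussSum n b (d + 1) q := by
  simp only [terminatingGaussSum, Finset.mul_sum, ← Finset.sum_sub_distrib]
  refine Finset.sum_congr rfl fun ij hij => ?_
  have h : ((ij.1 : ℂ) + ij.2) = n := by exact_mod_cast Finset.HasAntidiagonal.mem_antidiagonal.mp hij
  have h1 : b * (ascPochhammer ℂ ij.1).eval (b + 1) = (ascPochhammer ℂ ij.1).eval b * (b + ij.1) := by
    rw [← ascPochhammer_succ_eval_left, ascPochhammer_succ_eval]
  have h2 : (d + ij.1) * (ascPochhammer ℂ ij.2).eval (d + 1 + ij.1) =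
      (ascPochhammer ℂ ij.2).eval (d + ij.1) * (d + n) := by
    rw [show d + 1 + (ij.1 : ℂ) = d + ij.1 + 1 by ring, ← ascPochhammer_succ_eval_left,
      ascPochhammer_succ_eval, ← h]
    ring
  linear_combination
    -(n.choose ij.1 * (-q) ^ ij.1 * (ascPochhammer ℂ ij.2).eval (d + 1 + ij.1)) * h1
    - (n.choose ij.1 * (-q) ^ ij.1 * (ascPochhammer ℂ ij.1).eval b) * h2

/-- The linear transformation `q ↦ 1 - q` of the terminating Gauss sum. -/
theorem terminatingGaussSum_one_sub (n : ℕ) (b d r : ℂ) :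
    terminatingGaussSum n b (b - d - n + 1) r =
      (-1) ^ n * terminatingGaussSum n b d (1 - r) := by
  induction n generalizing b d with
  | zero => simp [terminatingGaussSum]
  | succ n ih =>
    -- The recurrence on either side involves only the parameters `(b, d+1)`, `(b+1, d+1)` and `(b,
    -- d)` at level `n`; eliminating the `q ↦ 1 - q` images leaves exactly the contiguous relation
    -- at `1 - r`.
    have h1 := ih b (d + 1)
    have h2 := ih (b + 1) (d + 1)
    rw [show b - (d + 1) - n + 1 = b - d - n by ring] at h1
    rw [show b + 1 - (d + 1) - n + 1 = b - d - n + 1 by ring] at h2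
    push_cast
    rw [show b - d - ((n : ℂ) + 1) + 1 = b - d - n by ring, terminatingGaussSum_succ,
      terminatingGaussSum_succ, h1, h2, pow_succ]
    linear_combination (-1) ^ n * terminatingGaussSum_contiguous n b d (1 - r)

theorem ascPochhammer_eval_neg_natCast {R : Type*} [CommRing R] (n k : ℕ) :
    (ascPochhammer R k).eval (-(n : R)) = (-1) ^ k * n.choose k * k.factorial := by
  rw [ascPochhammer_eval_neg_eq_descPochhammer, descPochhammer_eval_eq_descFactorial,
    Nat.descFactorial_eq_factorial_mul_choose]
  push_cast
  ring

theorem ascPochhammer_eval_natCast_add_one (m k : ℕ) :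
    (ascPochhammer ℂ k).eval ((m : ℂ) + 1) = (m + k).factorial / m.factorial := by
  rw [eq_div_iff (by exact_mod_cast m.factorial_ne_zero), mul_comm]
  exact_mod_cast factorial_mul_ascPochhammer ℂ m k

/-! ### Contour integrals along piecewise `C¹` paths -/

theorem curveIntegralFun_formDz {a b : ℂ} (γ : Path a b) (f : ℂ → ℂ) (t : ℝ) :
    curveIntegralFun (formDz f) γ t =
      f (γ.extend t) * derivWithin γ.extend (Icc 0 1) t := by
  simp [curveIntegralFun_def, formDz]

theorem contourIntegral_eq_intervalIntegral {a b : ℂ} (γ : Path a b) (f : ℂ → ℂ) :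
    contourIntegral γ f =
      ∫ t in (0 : ℝ)..1, f (γ.extend t) * derivWithin γ.extend (Icc 0 1) t := by
  simp [contourIntegral, curveIntegral_def, curveIntegralFun_formDz]

theorem curveIntegrable_formDz_iff {a b : ℂ} (γ : Path a b) (f : ℂ → ℂ) :
    CurveIntegrable (formDz f) γ ↔ IntervalIntegrable
      (fun t => f (γ.extend t) * derivWithin γ.extend (Icc 0 1) t) volume 0 1 := by
  simp only [CurveIntegrable, ← curveIntegralFun_formDz]

/-- Interval integrability may be checked on the pieces of a finite subdivision. -/
theorem intervalIntegrable_of_subdivision {g : ℝ → ℂ} (S : Finset ℝ) (p q : ℝ)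
    (h : ∀ u v : ℝ, p ≤ u → u < v → v ≤ q → Disjoint (Ioo u v) (S : Set ℝ) →
      IntervalIntegrable g volume u v) (hpq : p ≤ q) :
    IntervalIntegrable g volume p q := by
  classical
  induction hm : (S.filter (· ∈ Ioo p q)).card using Nat.strong_induction_on generalizing p q with
  | _ m ih =>
    rcases hpq.eq_or_lt with rfl | hlt
    · simp
    by_cases hd : Disjoint (Ioo p q) (S : Set ℝ)
    · exact h p q le_rfl hlt le_rfl hd
    · obtain ⟨s, hs, hsS⟩ := Set.not_disjoint_iff.mp hd
      -- Cutting at `s ∈ S` leaves fewer points of `S` in the interior of each half.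
      have key : ∀ p' q', p ≤ p' → q' ≤ q → p' ≤ q' → s ∉ Ioo p' q' →
          IntervalIntegrable g volume p' q' := by
        intro p' q' hp hq hpq' hsn
        refine ih _ ?_ p' q' (fun u v hu huv hv => h u v (hp.trans hu) huv (hv.trans hq)) hpq' rfl
        rw [← hm]
        refine Finset.card_lt_card (Finset.ssubset_iff_of_subset ?_ |>.mpr ⟨s, ?_, ?_⟩)
        · intro x hx
          simp only [Finset.mem_filter, mem_Ioo] at hx ⊢
          exact ⟨hx.1, hp.trans_lt hx.2.1, hx.2.2.trans_le hq⟩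
        · simp only [Finset.mem_filter]
          exact ⟨hsS, hs⟩
        · simp only [Finset.mem_filter]
          exact fun hx => hsn hx.2
      exact (key p s le_rfl hs.2.le hs.1.le (by simp)).trans
        (key s q hs.1.le le_rfl hs.2.le (by simp))

/-- On each `C¹` piece the derivative within the piece is continuous up to the endpoints, and it
agrees with the derivative within `[0, 1]` in the interior of the piece. -/
theorem DependentGaussian.IsPiecewiseC1.curveIntegrable {a b : ℂ} {γ : Path a b}
    (hγ : IsPiecewiseC1 γ) {f : ℂ → ℂ} (hf : ContinuousOn f (range γ)) : CurveIntegrable (formDz f) γ := by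
  rw [curveIntegrable_formDz_iff]
  obtain ⟨S, hS⟩ := hγ
  refine intervalIntegrable_of_subdivision S 0 1 (fun u v hu huv hv hd => ?_) zero_le_one
  have hc := hS u v hu huv hv hd
  have h1 : ContinuousOn
      (fun t => f (γ.extend t) * derivWithin γ.extend (Icc u v) t) (Icc u v) := by
    refine ContinuousOn.mul (hf.comp γ.continuous_extend.continuousOn fun t _ => ?_)
      (hc.continuousOn_derivWithin (uniqueDiffOn_Icc huv) le_rfl)
    rw [← γ.extend_range]
    exact mem_range_self t
  refine (h1.intervalIntegrable_of_Icc huv.le).congr_ae ?_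
  rw [uIoc_of_le huv.le, ← restrict_Ioo_eq_restrict_Ioc]
  filter_upwards [ae_restrict_mem measurableSet_Ioo] with t ht
  rw [derivWithin_of_mem_nhds (Icc_mem_nhds ht.1 ht.2),
    derivWithin_of_mem_nhds (Icc_mem_nhds (hu.trans_lt ht.1) (ht.2.trans_le hv))]

/-- **Cauchy's theorem** in the plane: entire functions have vanishing integral over closed
piecewise `C¹` contours. -/
theorem DependentGaussian.IsPiecewiseC1.contourIntegral_eq_zero {a : ℂ} {γ : Path a a}
    (hγ : IsPiecewiseC1 γ) {f : ℂ → ℂ} (hf : Differentiable ℂ f) : contourIntegral γ f = 0 := by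
  have hint := hγ.curveIntegrable hf.continuous.continuousOn
  rw [curveIntegrable_formDz_iff] at hint
  -- A primitive on the whole plane; `F ∘ γ` then obeys the fundamental theorem of calculus off the
  -- finite set `S`.
  obtain ⟨F, hF⟩ := hf.isExactOn_univ
  obtain ⟨S, hS⟩ := hγ
  have hFd : ∀ z, HasDerivAt F (f z) z := fun z => hF z (mem_univ z)
  have hFc : Continuous F := continuous_iff_continuousAt.mpr fun z => (hFd z).continuousAt
  rw [contourIntegral_eq_intervalIntegral,
    integral_eq_of_hasDerivAt_off_countable (fun t => F (γ.extend t)) _ S.countable_toSet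
      (hFc.comp γ.continuous_extend).continuousOn ?_ hint]
  · simp
  · intro t ht
    simp only [min_eq_left (zero_le_one' ℝ), max_eq_right (zero_le_one' ℝ)] at ht
    obtain ⟨⟨h0, h1⟩, htS⟩ := ht
    have hopen : IsOpen ((S : Set ℝ)ᶜ ∩ Ioo 0 1) :=
      S.finite_toSet.isClosed.isOpen_compl.inter isOpen_Ioo
    obtain ⟨ε, hε, hball⟩ := Metric.isOpen_iff.mp hopen t ⟨htS, h0, h1⟩
    rw [Real.ball_eq_Ioo] at hball
    have hsub : Icc (t - ε / 2) (t + ε / 2) ⊆ (S : Set ℝ)ᶜ ∩ Ioo 0 1 :=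
      fun x hx => hball ⟨by linarith [hx.1], by linarith [hx.2]⟩
    have hl := (hsub ⟨le_rfl, by linarith⟩ : t - ε / 2 ∈ _)
    have hr := (hsub ⟨by linarith, le_rfl⟩ : t + ε / 2 ∈ _)
    have hc := hS (t - ε / 2) (t + ε / 2) hl.2.1.le (by linarith) hr.2.2.le
      (Set.disjoint_left.mpr fun x hx => (hsub (Ioo_subset_Icc_self hx)).1)
    have hd : DifferentiableAt ℝ γ.extend t :=
      ((hc.differentiableOn one_ne_zero) t ⟨by linarith, by linarith⟩).differentiableAt
        (Icc_mem_nhds (by linarith) (by linarith))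
    rw [derivWithin_of_mem_nhds (Icc_mem_nhds h0 h1)]
    exact (hFd (γ.extend t)).comp_of_eq t hd.hasDerivAt rfl

/-- Along any path, the 1-form `f dz` may be changed on a countable set. -/
theorem curveIntegralFun_formDz_congr_ae {a b : ℂ} (γ : Path a b) {f g : ℂ → ℂ} {T : Set ℂ}
    (hT : T.Countable) (hfg : ∀ z ∈ range γ, z ∉ T → f z = g z) :
    curveIntegralFun (formDz f) γ =ᵐ[volume.restrict (uIoc 0 1)]
      curveIntegralFun (formDz g) γ := by
  -- A visit to `w` with nonzero velocity is isolated among the visits to `w`, so there are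
  -- countably many; where the velocity vanishes, the value of the form is irrelevant.
  have hcount : ∀ w : ℂ, {t ∈ Icc (0 : ℝ) 1 |
      γ.extend t = w ∧ derivWithin γ.extend (Icc 0 1) t ≠ 0}.Countable := by
    intro w
    refine (countable_setOfPred_isolated_right_within
      (s := {t ∈ Icc (0 : ℝ) 1 | γ.extend t = w})).mono ?_
    rintro t ⟨ht, htw, hd⟩
    refine ⟨⟨ht, htw⟩, ?_⟩
    have hne := (differentiableWithinAt_of_derivWithin_ne_zero hd).hasDerivWithinAt.eventually_ne
      (c := w) hd
    rw [← Filter.empty_mem_iff_bot]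
    have hmono : {t ∈ Icc (0 : ℝ) 1 | γ.extend t = w} ∩ Ioi t ⊆ Icc 0 1 \ {t} :=
      fun x hx => ⟨hx.1.1, hx.2.ne'⟩
    filter_upwards [nhdsWithin_mono t hmono hne, self_mem_nhdsWithin] with x hx hx'
    exact hx hx'.1.2
  have hnull := (hT.biUnion fun w _ => hcount w).ae_notMem (volume : Measure ℝ)
  rw [uIoc_of_le zero_le_one]
  filter_upwards [ae_restrict_of_ae hnull, ae_restrict_mem measurableSet_Ioc] with t ht ht'
  rw [curveIntegralFun_formDz, curveIntegralFun_formDz]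
  by_cases htT : γ.extend t ∈ T
  · have : derivWithin γ.extend (Icc 0 1) t = 0 := by
      by_contra hd
      exact ht (mem_biUnion htT ⟨Ioc_subset_Icc_self ht', rfl, hd⟩)
    simp [this]
  · rw [hfg _ (by rw [← γ.extend_range]; exact mem_range_self t) htT]

theorem contourIntegral_congr_off_countable {a b : ℂ} (γ : Path a b) {f g : ℂ → ℂ} {T : Set ℂ}
    (hT : T.Countable) (hfg : ∀ z ∈ range γ, z ∉ T → f z = g z) :
    contourIntegral γ f = contourIntegral γ g := by
  rw [contourIntegral, contourIntegral, curveIntegral_def, curveIntegral_def]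
  exact intervalIntegral.integral_congr_ae_restrict (curveIntegralFun_formDz_congr_ae γ hT hfg)

theorem curveIntegrable_congr_off_countable {a b : ℂ} (γ : Path a b) {f g : ℂ → ℂ} {T : Set ℂ}
    (hT : T.Countable) (hfg : ∀ z ∈ range γ, z ∉ T → f z = g z)
    (hg : CurveIntegrable (formDz g) γ) : CurveIntegrable (formDz f) γ :=
  IntervalIntegrable.congr_ae hg (curveIntegralFun_formDz_congr_ae γ hT hfg).symm

theorem contourIntegral_sum {a b : ℂ} (γ : Path a b) {ι : Type*} (s : Finset ι) {f : ι → ℂ → ℂ}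
    (hf : ∀ i ∈ s, CurveIntegrable (formDz (f i)) γ) :
    contourIntegral γ (fun z => ∑ i ∈ s, f i z) = ∑ i ∈ s, contourIntegral γ (f i) := by
  simp only [contourIntegral_eq_intervalIntegral, Finset.sum_mul]
  exact intervalIntegral.integral_finsetSum fun i hi =>
    (curveIntegrable_formDz_iff γ (f i)).mp (hf i hi)

theorem contourIntegral_add {a b : ℂ} (γ : Path a b) {f g : ℂ → ℂ}
    (hf : CurveIntegrable (formDz f) γ) (hg : CurveIntegrable (formDz g) γ) :
    contourIntegral γ (fun z => f z + g z) = contourIntegral γ f + contourIntegral γ g := by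
  simp only [contourIntegral_eq_intervalIntegral, add_mul]
  exact intervalIntegral.integral_add ((curveIntegrable_formDz_iff γ f).mp hf)
    ((curveIntegrable_formDz_iff γ g).mp hg)

theorem contourIntegral_const_mul {a b : ℂ} (γ : Path a b) (c : ℂ) (f : ℂ → ℂ) :
    contourIntegral γ (fun z => c * f z) = c * contourIntegral γ f := by
  simp only [contourIntegral_eq_intervalIntegral, mul_assoc, intervalIntegral.integral_const_mul]

/-- **Cauchy's integral formula** for entire functions and closed piecewise `C¹` contours. -/
theorem DependentGaussian.IsPiecewiseC1.contourIntegral_div_sub {a : ℂ} {γ : Path a a}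
    (hγ : IsPiecewiseC1 γ) {E : ℂ → ℂ} (hE : Differentiable ℂ E) {w : ℂ} (hw : w ∉ range γ) :
    contourIntegral γ (fun z => E z / (z - w)) =
      2 * Real.pi * Complex.I * windingNumber γ w * E w := by
  -- `(E z - E w) / (z - w)` has a removable singularity, so only `E w / (z - w)` contributes.
  have hdiff : Differentiable ℂ (dslope E w) := by
    rw [← differentiableOn_univ] at hE ⊢
    exact (Complex.differentiableOn_dslope univ_mem).mpr hE
  have hcont : ContinuousOn (fun z : ℂ => 1 / (z - w)) (range γ) :=
    continuousOn_const.div (by fun_prop) fun z hz => sub_ne_zero.mpr fun h => hw (h ▸ hz)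
  have heq : contourIntegral γ (fun z => E z / (z - w)) =
      contourIntegral γ (fun z => dslope E w z + E w * (1 / (z - w))) := by
    refine contourIntegral_congr_off_countable γ countable_empty fun z hz _ => ?_
    have hne : z ≠ w := fun h => hw (h ▸ hz)
    have hne' := sub_ne_zero.mpr hne
    rw [dslope_of_ne _ hne, slope_def_field]
    field_simp
    ring
  rw [heq, contourIntegral_add γ (hγ.curveIntegrable hdiff.continuous.continuousOn)
      (hγ.curveIntegrable (f := fun z => E w * (1 / (z - w))) (continuousOn_const.mul hcont)),
    hγ.contourIntegral_eq_zero hdiff, contourIntegral_const_mul, windingNumber]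
  field_simp
  ring

/-! ### The regularized `₀F₁` is entire in its parameter -/

/-- The regularized series `₀F₁(-; t + 1; z) / Γ(t + 1)`, as a function of the parameter `t`. -/
noncomputable def regularized0F1 (z t : ℂ) : ℂ :=
  ∑' k : ℕ, z ^ k / (k.factorial : ℂ) * (Complex.Gamma (t + 1 + k))⁻¹

/-- Uniformity in `k` supplies the M-test. Compactness handles `k ≤ N` with `N ≥ R`; beyond that,
passing from `k` to `k + 1` divides by `t + 1 + k`, of norm at least 1. -/
theorem exists_norm_inv_Gamma_add_natCast_le (R : ℝ) :
    ∃ M : ℝ, ∀ k : ℕ, ∀ t ∈ Metric.ball (0 : ℂ) R, ‖(Complex.Gamma (t + 1 + k))⁻¹‖ ≤ M := by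
  have hex : ∀ k : ℕ, ∃ M : ℝ, 0 ≤ M ∧
      ∀ t ∈ Metric.ball (0 : ℂ) R, ‖(Complex.Gamma (t + 1 + k))⁻¹‖ ≤ M := by
    intro k
    have hc : Continuous fun t : ℂ => (Complex.Gamma (t + 1 + k))⁻¹ :=
      Complex.differentiable_one_div_Gamma.continuous.comp (by fun_prop)
    obtain ⟨M, hM⟩ := (isCompact_closedBall (0 : ℂ) R).exists_bound_of_continuousOn hc.continuousOn
    exact ⟨max M 0, le_max_right _ _,
      fun t ht => (hM t (Metric.ball_subset_closedBall ht)).trans (le_max_left _ _)⟩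
  choose M hM0 hM using hex
  obtain ⟨N, hN⟩ := exists_nat_ge R
  refine ⟨∑ k ∈ Finset.range (N + 1), M k, fun k t ht => ?_⟩
  have hsmall : ∀ k ≤ N, ‖(Complex.Gamma (t + 1 + k))⁻¹‖ ≤ ∑ k ∈ Finset.range (N + 1), M k :=
    fun k hk => (hM k t ht).trans (Finset.single_le_sum (f := M) (fun i _ => hM0 i)
      (Finset.mem_range.mpr (by omega)))
  rcases le_total k N with hk | hk
  · exact hsmall k hk
  · induction k, hk using Nat.le_induction with
    | base => exact hsmall N le_rfl
    | succ k hk ih =>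
      have ht' : ‖t‖ < R := by simpa using ht
      have hkN : (N : ℝ) ≤ k := by exact_mod_cast hk
      have hre : 1 ≤ ‖t + 1 + k‖ := by
        have h1 := Complex.abs_re_le_norm t
        have h2 := Complex.re_le_norm (t + 1 + k)
        simp only [Complex.add_re, Complex.one_re, Complex.natCast_re] at h2
        linarith [(abs_le.mp h1).1]
      have hne : t + 1 + k ≠ 0 := norm_ne_zero_iff.mp (by linarith)
      rw [show t + 1 + ((k + 1 : ℕ) : ℂ) = t + 1 + k + 1 by push_cast; ring,
        Complex.Gamma_add_one _ hne, mul_inv, norm_mul]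
      refine (mul_le_of_le_one_left (norm_nonneg _) ?_).trans ih
      rw [norm_inv]
      exact inv_le_one_of_one_le₀ hre

theorem differentiable_regularized0F1 (z : ℂ) : Differentiable ℂ (regularized0F1 z) := by
  intro t
  obtain ⟨M, hM⟩ := exists_norm_inv_Gamma_add_natCast_le (‖t‖ + 1)
  have hd : DifferentiableOn ℂ (regularized0F1 z) (Metric.ball 0 (‖t‖ + 1)) := by
    refine Complex.differentiableOn_tsum_of_summable_norm
      (u := fun k : ℕ => ‖z‖ ^ k / (k.factorial : ℝ) * M)
      ((Real.summable_pow_div_factorial ‖z‖).mul_right M) (fun k => ?_) Metric.isOpen_ball ?_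
    · refine Differentiable.differentiableOn (Differentiable.const_mul ?_ _)
      exact Complex.differentiable_one_div_Gamma.comp (by fun_prop)
    · intro k w hw
      rw [norm_mul, norm_div, norm_pow, Complex.norm_natCast]
      exact mul_le_mul_of_nonneg_left (hM k w hw) (by positivity)
  exact (hd t (by simp)).differentiableAt (Metric.isOpen_ball.mem_nhds (by simp))

theorem hypergeometric0F1_div_Gamma {t : ℂ} (ht : ∀ m : ℕ, t + 1 ≠ -m) (z : ℂ) :
    hypergeometric0F1 (t + 1) z / Complex.Gamma (t + 1) = regularized0F1 z t := by
  rw [hypergeometric0F1, regularized0F1, ← tsum_div_const]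
  refine tsum_congr fun k => ?_
  have h0 := Complex.Gamma_ne_zero ht
  have h1 : Complex.Gamma (t + 1 + k) ≠ 0 := by
    refine Complex.Gamma_ne_zero fun m h => ht (m + k) ?_
    push_cast
    linear_combination h
  rw [← Complex.Gamma_add_nat_div_Gamma_eq _ ht]
  field_simp

/-! ### Partial fractions and the contour integral for `P` -/

theorem ascPochhammer_eval_sub_natCast (n : ℕ) (t : ℂ) :
    (ascPochhammer ℂ (n + 1)).eval (t - n) = ∏ j ∈ Finset.range (n + 1), (t - j) := by
  induction n with
  | zero => simp
  | succ n ih =>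
    rw [ascPochhammer_succ_eval_left, Finset.prod_range_succ, ← ih]
    push_cast
    rw [show t - ((n : ℂ) + 1) + 1 = t - n by ring, mul_comm]

theorem prod_erase_natCast_sub {n k : ℕ} (hk : k ≤ n) :
    ∏ j ∈ (Finset.range (n + 1)).erase k, ((k : ℂ) - j) =
      (-1) ^ (n - k) * (k.factorial * (n - k).factorial) := by
  induction n, hk using Nat.le_induction with
  | base =>
    rw [Finset.range_add_one, Finset.erase_insert (by simp)]
    simp only [Nat.sub_self, pow_zero, Nat.factorial_zero, Nat.cast_one, mul_one, one_mul]
    rw [← Finset.prod_range_reflect, ← Finset.prod_range_add_one_eq_factorial]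
    push_cast
    refine Finset.prod_congr rfl fun j hj => ?_
    have hj' := Finset.mem_range.mp hj
    rw [show k - 1 - j = k - (j + 1) by omega, Nat.cast_sub (by omega)]
    push_cast
    ring
  | succ n hk ih =>
    rw [Finset.range_add_one, Finset.erase_insert_of_ne (by omega),
      Finset.prod_insert (by simp), ih, Nat.succ_sub hk, pow_succ, Nat.factorial_succ]
    push_cast [Nat.cast_sub hk]
    ring

/-- Lagrange interpolation of the constant 1 at the nodes `0, …, n`, evaluated off the nodes. -/
theorem inv_prod_sub_natCast {n : ℕ} {t : ℂ} (ht : ∀ k ≤ n, t ≠ k) :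
    (∏ j ∈ Finset.range (n + 1), (t - j))⁻¹ =
      ∑ k ∈ Finset.range (n + 1),
        (-1) ^ (n - k) / ((k.factorial : ℂ) * (n - k).factorial) * (t - k)⁻¹ := by
  have hx : ∀ i ∈ Finset.range (n + 1), t ≠ ((fun j : ℕ => (j : ℂ)) i) :=
    fun i hi => ht i (Finset.mem_range_succ_iff.mp hi)
  have h := Lagrange.eval_interpolate_not_at_node (s := Finset.range (n + 1))
    (v := fun j : ℕ => (j : ℂ)) (x := t) 1 hx
  rw [Lagrange.interpolate_one (Nat.cast_injective.injOn) ⟨0, by simp⟩, Polynomial.eval_one,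
    Lagrange.eval_nodal] at h
  rw [inv_eq_of_mul_eq_one_right h.symm]
  refine Finset.sum_congr rfl fun k hk => ?_
  rw [Lagrange.nodalWeight, Finset.prod_inv_distrib,
    prod_erase_natCast_sub (Finset.mem_range_succ_iff.mp hk), Pi.one_apply, mul_one, mul_inv,
    ← inv_pow, inv_neg_one, div_eq_mul_inv]

/-- The entire function whose residues at `0, …, n`, after division by `t (t - 1) ⋯ (t - n)`,
give the function `P_n`. -/
noncomputable def entireFactorP (μ : ℝ) (ν : ℕ) (x : ℝ) (t : ℂ) : ℂ :=
  ((α μ ^ 2 - δ μ ^ 2 : ℝ) : ℂ) ^ t * (x : ℂ) ^ t * (Complex.Gamma (t + ν + 1))⁻¹ *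
    regularized0F1 ((δ μ ^ 2 * x : ℝ) : ℂ) t

theorem α_sq_sub_δ_sq {μ : ℝ} (hμ : 0 < μ) : α μ ^ 2 - δ μ ^ 2 = 1 / μ := by
  rw [α, δ]
  field_simp
  ring

theorem differentiable_entireFactorP {μ : ℝ} (hμ : 0 < μ) (ν : ℕ) {x : ℝ} (hx : 0 < x) :
    Differentiable ℂ (entireFactorP μ ν x) := by
  have hA : ((α μ ^ 2 - δ μ ^ 2 : ℝ) : ℂ) ≠ 0 := by
    rw [α_sq_sub_δ_sq hμ]
    exact Complex.ofReal_ne_zero.mpr (by positivity)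
  have hx' : (x : ℂ) ≠ 0 := Complex.ofReal_ne_zero.mpr hx.ne'
  refine Differentiable.mul (Differentiable.mul (Differentiable.mul ?_ ?_) ?_)
    (differentiable_regularized0F1 _)
  · exact fun t => differentiableAt_id.const_cpow (Or.inl hA)
  · exact fun t => differentiableAt_id.const_cpow (Or.inl hx')
  · exact Complex.differentiable_one_div_Gamma.comp (by fun_prop)

theorem integrandP_eq_sum (μ : ℝ) (ν n : ℕ) (x : ℝ) {t : ℂ} (ht : ∀ m : ℤ, t ≠ m) :
    integrandP μ ν n x t = ∑ k ∈ Finset.range (n + 1),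
      (-1) ^ (n - k) / ((k.factorial : ℂ) * (n - k).factorial) *
        (entireFactorP μ ν x t / (t - k)) := by
  have h1 : ∀ m : ℕ, t + 1 ≠ -m := fun m h => ht (-m - 1) (by
    push_cast
    linear_combination h)
  have h2 : ∀ m : ℕ, t - n ≠ -m := fun m h => ht (n - m) (by
    push_cast
    linear_combination h)
  have hG1 := Complex.Gamma_ne_zero h1
  have hG2 := Complex.Gamma_ne_zero h2
  have hprod := Complex.Gamma_add_nat_div_Gamma_eq (n := n + 1) _ h2
  rw [ascPochhammer_eval_sub_natCast,
    show t - n + ((n + 1 : ℕ) : ℂ) = t + 1 by push_cast; ring] at hprod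
  have hpf := inv_prod_sub_natCast (n := n) (t := t) fun k _ => by simpa using ht k
  have hsum : ∑ k ∈ Finset.range (n + 1),
      (-1) ^ (n - k) / ((k.factorial : ℂ) * (n - k).factorial) *
        (entireFactorP μ ν x t / (t - k)) =
      entireFactorP μ ν x t * (Complex.Gamma (t - n) / Complex.Gamma (t + 1)) := by
    rw [← inv_div, hprod, hpf, Finset.mul_sum]
    exact Finset.sum_congr rfl fun k _ => by ring
  rw [hsum, entireFactorP, ← hypergeometric0F1_div_Gamma h1, integrandP]
  field_simp

/-- The contour may run through integers outside `0, …, n`, where the integrand can take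
conventional values of `Γ` at poles; these form a countable set and do not affect the integral. -/
theorem curveIntegrable_and_contourIntegral_integrandP {μ : ℝ} (hμ : 0 < μ) (ν n : ℕ) {x : ℝ} (hx : 0 < x) {a : ℂ}
    {γ : Path a a} (hγ : EncirclesOnce γ n) :
    CurveIntegrable (formDz (integrandP μ ν n x)) γ ∧
      contourIntegral γ (integrandP μ ν n x) = 2 * Real.pi * Complex.I *
        ∑ k ∈ Finset.range (n + 1), (-1) ^ (n - k) / ((k.factorial : ℂ) * (n - k).factorial) *
          entireFactorP μ ν x k := by
  have hE := differentiable_entireFactorP hμ ν hx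
  have hcongr : ∀ z ∈ range γ, z ∉ range (fun m : ℤ => (m : ℂ)) →
      integrandP μ ν n x z = ∑ k ∈ Finset.range (n + 1),
        (-1) ^ (n - k) / ((k.factorial : ℂ) * (n - k).factorial) *
          (entireFactorP μ ν x z / (z - k)) :=
    fun z _ hz => integrandP_eq_sum μ ν n x fun m hm => hz ⟨m, hm.symm⟩
  have hcont : ∀ k ∈ Finset.range (n + 1), ContinuousOn (fun z =>
      (-1) ^ (n - k) / ((k.factorial : ℂ) * (n - k).factorial) *
        (entireFactorP μ ν x z / (z - k))) (range γ) := fun k hk =>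
    continuousOn_const.mul (hE.continuous.continuousOn.div (by fun_prop) fun z hz =>
      sub_ne_zero.mpr fun h => hγ.avoids k (Finset.mem_range_succ_iff.mp hk) (h ▸ hz))
  constructor
  · exact curveIntegrable_congr_off_countable γ (countable_range _) hcongr
      (hγ.piecewiseC1.curveIntegrable (continuousOn_finsetSum _ hcont))
  · rw [contourIntegral_congr_off_countable γ (countable_range _) hcongr,
      contourIntegral_sum γ _ fun k hk => hγ.piecewiseC1.curveIntegrable (hcont k hk),
      Finset.mul_sum]
    refine Finset.sum_congr rfl fun k hk => ?_
    have hk' := Finset.mem_range_succ_iff.mp hk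
    rw [contourIntegral_const_mul, hγ.piecewiseC1.contourIntegral_div_sub hE (hγ.avoids k hk'),
      hγ.winding k hk']
    ring

/-! ### Bessel functions `I_k` as values of the entire factor -/

theorem besselI_natCast_eq {d x : ℝ} (hd : 0 < d) (hx : 0 < x) (k : ℕ) :
    (besselI k (2 * d * Real.sqrt x) : ℂ) =
      ((d * Real.sqrt x) ^ k : ℝ) * regularized0F1 ((d ^ 2 * x : ℝ) : ℂ) k := by
  have hpos : 0 < d * Real.sqrt x := mul_pos hd (Real.sqrt_pos.mpr hx)
  rw [besselI, regularized0F1, Complex.ofReal_tsum, ← tsum_mul_left]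
  refine tsum_congr fun m => ?_
  have hG : Complex.Gamma ((k : ℂ) + 1 + m) = ((k + m).factorial : ℂ) := by
    rw [← Complex.Gamma_nat_eq_factorial]
    push_cast
    ring_nf
  have hG' : Real.Gamma ((k : ℝ) + m + 1) = ((k + m).factorial : ℝ) := by
    rw [← Real.Gamma_nat_eq_factorial]
    push_cast
    ring_nf
  have hp : (2 * d * Real.sqrt x / 2) ^ (2 * (m : ℝ) + k) =
      (d * Real.sqrt x) ^ k * (d ^ 2 * x) ^ m := by
    rw [show 2 * d * Real.sqrt x / 2 = d * Real.sqrt x by ring,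
      show 2 * (m : ℝ) + k = ((2 * m + k : ℕ) : ℝ) by push_cast; ring, Real.rpow_natCast,
      pow_add, pow_mul, mul_pow d _ 2, Real.sq_sqrt hx.le]
    ring
  rw [hG, hG', hp]
  push_cast
  ring

theorem rpow_half_mul_besselI_natCast {d x : ℝ} (hd : 0 < d) (hx : 0 < x) (k : ℕ) :
    ((x ^ ((k : ℝ) / 2) * besselI k (2 * d * Real.sqrt x) : ℝ) : ℂ) =
      (d : ℂ) ^ k * (x : ℂ) ^ k * regularized0F1 ((d ^ 2 * x : ℝ) : ℂ) k := by
  have h : x ^ ((k : ℝ) / 2) * (d * Real.sqrt x) ^ k = d ^ k * x ^ k := by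
    rw [show (k : ℝ) / 2 = 1 / 2 * k by ring, Real.rpow_mul hx.le, ← Real.sqrt_eq_rpow,
      Real.rpow_natCast, mul_pow, mul_left_comm, ← mul_pow, Real.mul_self_sqrt hx.le]
  rw [Complex.ofReal_mul, besselI_natCast_eq hd hx, ← mul_assoc, ← Complex.ofReal_mul, h]
  push_cast
  ring

theorem P_eq_sum_entireFactorP {μ : ℝ} (hμ0 : 0 < μ) (hμ1 : μ < 1) (ν n : ℕ) {x : ℝ}
    (hx : 0 < x) :
    (P μ ν n x : ℂ) = ((ν + n).factorial : ℂ) * (n.factorial : ℂ) ^ 2 *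
      (((α μ ^ 2 - δ μ ^ 2) ^ (1 / 2 : ℝ) : ℝ) : ℂ) *
        ∑ k ∈ Finset.range (n + 1), (-1) ^ (n - k) / ((k.factorial : ℂ) * (n - k).factorial) *
          entireFactorP μ ν x k := by
  have hA : 0 < α μ ^ 2 - δ μ ^ 2 := by
    rw [α_sq_sub_δ_sq hμ0]
    positivity
  have hδ : 0 < δ μ := div_pos (by linarith) (by linarith)
  rw [P, Complex.ofReal_mul, Complex.ofReal_sum, Finset.mul_sum, Finset.mul_sum]
  refine Finset.sum_congr rfl fun k hk => ?_
  have hk' := Finset.mem_range_succ_iff.mp hk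
  have hG : Complex.Gamma ((k : ℂ) + ν + 1) = ((ν + k).factorial : ℂ) := by
    rw [← Complex.Gamma_nat_eq_factorial]
    push_cast
    ring_nf
  -- The sign of `(-n)_k` turns `(-1)^n` into the sign `(-1)^(n-k)` of the partial fraction
  -- coefficient.
  have hsign : (-1 : ℂ) ^ n = (-1) ^ (n - k) * (-1) ^ k := by
    rw [← pow_add, Nat.sub_add_cancel hk']
  have hsq : (-1 : ℂ) ^ k * (-1) ^ k = 1 := by rw [← mul_pow]; simp
  have hfac : (n.choose k : ℂ) * k.factorial * (n - k).factorial = n.factorial := by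
    exact_mod_cast Nat.choose_mul_factorial_mul_factorial hk'
  rw [mul_assoc _ (x ^ ((k : ℝ) / 2)), Complex.ofReal_mul _ (x ^ ((k : ℝ) / 2) * _),
    rpow_half_mul_besselI_natCast hδ hx, entireFactorP, hG, ascPochhammer_eval_neg_natCast, Real.rpow_add hA,
    Real.rpow_natCast, Complex.cpow_natCast, Complex.cpow_natCast]
  have hδ' : (δ μ : ℂ) ≠ 0 := Complex.ofReal_ne_zero.mpr hδ.ne'
  have f1 : (k.factorial : ℂ) ≠ 0 := by exact_mod_cast k.factorial_ne_zero
  have f2 : ((n - k).factorial : ℂ) ≠ 0 := by exact_mod_cast (n - k).factorial_ne_zero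
  have f3 : ((ν + k).factorial : ℂ) ≠ 0 := by exact_mod_cast (ν + k).factorial_ne_zero
  push_cast
  rw [hsign, ← hfac]
  field_simp
  linear_combination ((ν + n).factorial : ℂ) * (n.choose k : ℂ) ^ 2 *
    (((α μ ^ 2 - δ μ ^ 2) ^ (1 / 2 : ℝ) : ℝ) : ℂ) * (x : ℂ) ^ k *
    regularized0F1 ((δ μ : ℂ) ^ 2 * x) k * ((α μ : ℂ) ^ 2 - (δ μ : ℂ) ^ 2) ^ k * hsq

/-! ### Mellin transform and inversion for `K_κ` -/

/-- The integrand of `∫₀^∞ u^{κ-1} exp(-u - Y/u) du = 2 Y^{κ/2} K_κ(2 √Y)`. -/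
noncomputable def besselKernel (κ Y u : ℝ) : ℝ :=
  u ^ (κ - 1) * Real.exp (-u) * Real.exp (-(1 / u * Y))

theorem measurable_besselKernel_uncurry (κ : ℝ) :
    Measurable fun p : ℝ × ℝ => besselKernel κ p.1 p.2 := by
  unfold besselKernel
  fun_prop

theorem besselKernel_nonneg {u : ℝ} (hu : 0 ≤ u) (κ Y : ℝ) : 0 ≤ besselKernel κ Y u := by
  unfold besselKernel
  positivity

theorem integrableOn_besselKernel {κ Y : ℝ} (hκ : 0 ≤ κ) (hY : 0 < Y) :
    IntegrableOn (besselKernel κ Y) (Ioi 0) := by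
  have h := (Real.GammaIntegral_convergent (s := κ + 1) (by linarith)).const_mul (1 / Y)
  refine h.mono' ?_ ?_
  · exact ((measurable_besselKernel_uncurry κ).comp
      (measurable_const.prodMk measurable_id)).aestronglyMeasurable
  · filter_upwards [ae_restrict_mem measurableSet_Ioi] with u hu
    have hu : 0 < u := hu
    rw [Real.norm_of_nonneg (besselKernel_nonneg hu.le κ Y), besselKernel, add_sub_cancel_right,
      Real.rpow_sub_one hu.ne']
    -- The extra power of `u` secures integrability at 0 even when `κ = 0`.
    have hle : Real.exp (-(1 / u * Y)) ≤ u / Y := by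
      rw [Real.exp_neg, ← one_div, div_le_div_iff₀ (Real.exp_pos _) hY, one_mul]
      have := Real.add_one_le_exp (1 / u * Y)
      calc Y = u * (1 / u * Y) := by field_simp
        _ ≤ u * Real.exp (1 / u * Y) := by gcongr; linarith
    calc u ^ κ / u * Real.exp (-u) * Real.exp (-(1 / u * Y))
        ≤ u ^ κ / u * Real.exp (-u) * (u / Y) := by gcongr
      _ = 1 / Y * (Real.exp (-u) * u ^ κ) := by field_simp

/-- Needed for Mellin inversion to hold pointwise. The kernel decreases in `Y`, so its value at `Y /
2` dominates nearby. -/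
theorem continuousAt_integral_besselKernel {κ Y : ℝ} (hκ : 0 ≤ κ) (hY : 0 < Y) :
    ContinuousAt (fun Y => ∫ u in Ioi (0 : ℝ), besselKernel κ Y u) Y := by
  refine continuousAt_of_dominated (bound := besselKernel κ (Y / 2))
    (Eventually.of_forall fun Z => ((measurable_besselKernel_uncurry κ).comp
      (measurable_const.prodMk measurable_id)).aestronglyMeasurable) ?_
    (integrableOn_besselKernel hκ (half_pos hY)) ?_
  · filter_upwards [lt_mem_nhds (half_lt_self hY)] with Z hZ
    filter_upwards [ae_restrict_mem measurableSet_Ioi] with u hu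
    have hu : 0 < u := hu
    rw [Real.norm_of_nonneg (besselKernel_nonneg hu.le κ Z)]
    unfold besselKernel
    gcongr
  · refine Eventually.of_forall fun u => ?_
    unfold besselKernel
    fun_prop

/-- Justifies Fubini: integrating absolute values over `Y` first gives `Γ(σ) u^σ` with `σ = Re s`,
and a Gamma integral at `κ + σ` remains. -/
theorem integrable_cpow_mul_besselKernel_prod {κ : ℝ} (hκ : 0 ≤ κ) {s : ℂ} (hs : 0 < s.re) :
    Integrable (fun p : ℝ × ℝ => (p.1 : ℂ) ^ (s - 1) * (besselKernel κ p.1 p.2 : ℂ))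
      ((volume.restrict (Ioi 0)).prod (volume.restrict (Ioi 0))) := by
  have hmeas : Measurable
      (fun p : ℝ × ℝ => (p.1 : ℂ) ^ (s - 1) * (besselKernel κ p.1 p.2 : ℂ)) :=
    ((Complex.measurable_ofReal.comp measurable_fst).pow_const _).mul
      (Complex.measurable_ofReal.comp (measurable_besselKernel_uncurry κ))
  have hnorm : ∀ u : ℝ, 0 < u → ∀ Y : ℝ, 0 < Y →
      ‖(Y : ℂ) ^ (s - 1) * (besselKernel κ Y u : ℂ)‖ =
        u ^ (κ - 1) * Real.exp (-u) * (Y ^ (s.re - 1) * Real.exp (-(1 / u * Y))) := by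
    intro u hu Y hY
    rw [norm_mul, Complex.norm_cpow_eq_rpow_re_of_pos hY, Complex.norm_real,
      Real.norm_of_nonneg (besselKernel_nonneg hu.le κ Y), besselKernel, Complex.sub_re,
      Complex.one_re]
    ring
  refine (integrable_prod_iff' hmeas.aestronglyMeasurable).mpr ⟨?_, ?_⟩
  · filter_upwards [ae_restrict_mem measurableSet_Ioi] with u hu
    have hu : 0 < u := hu
    have h := (integrableOn_rpow_mul_exp_neg_mul_rpow (s := s.re - 1) (by linarith) one_pos
      (one_div_pos.mpr hu)).const_mul (u ^ (κ - 1) * Real.exp (-u))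
    refine h.mono' (hmeas.comp (measurable_id.prodMk measurable_const)).aestronglyMeasurable ?_
    filter_upwards [ae_restrict_mem measurableSet_Ioi] with Y hY
    rw [hnorm u hu Y hY, Real.rpow_one, neg_mul]
  · have h := (Real.GammaIntegral_convergent (s := κ + s.re) (by linarith)).const_mul
      (Real.Gamma s.re)
    refine IntegrableOn.congr_fun h (fun u hu => ?_) measurableSet_Ioi
    have hu : 0 < u := hu
    simp only
    rw [setIntegral_congr_fun measurableSet_Ioi (hnorm u hu), integral_const_mul,
      Real.integral_rpow_mul_exp_neg_mul_Ioi hs (one_div_pos.mpr hu), one_div_one_div,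
      show κ + s.re - 1 = κ - 1 + s.re by ring, Real.rpow_add hu]
    ring

theorem mellinConvergent_integral_besselKernel {κ : ℝ} (hκ : 0 ≤ κ) {s : ℂ} (hs : 0 < s.re) :
    MellinConvergent (fun Y => ((∫ u in Ioi (0 : ℝ), besselKernel κ Y u : ℝ) : ℂ)) s := by
  have h := (integrable_cpow_mul_besselKernel_prod hκ hs).integral_prod_left
  simpa only [MellinConvergent, IntegrableOn, smul_eq_mul, integral_const_mul,
    integral_complex_ofReal] using h

theorem mellin_integral_besselKernel {κ : ℝ} (hκ : 0 ≤ κ) {s : ℂ} (hs : 0 < s.re) :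
    mellin (fun Y => ((∫ u in Ioi (0 : ℝ), besselKernel κ Y u : ℝ) : ℂ)) s =
      Complex.Gamma s * Complex.Gamma (s + κ) := by
  have hswap := integral_integral_swap
    (f := fun Y u : ℝ => (Y : ℂ) ^ (s - 1) * (besselKernel κ Y u : ℂ))
    (integrable_cpow_mul_besselKernel_prod hκ hs)
  simp only [integral_const_mul, integral_complex_ofReal] at hswap
  simp only [mellin, smul_eq_mul]
  rw [hswap, Complex.Gamma_eq_integral (s := s + κ) (by simp; linarith), Complex.GammaIntegral,
    ← integral_const_mul]
  refine setIntegral_congr_fun measurableSet_Ioi fun u hu => ?_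
  have hu : 0 < u := hu
  have hu' : (u : ℂ) ≠ 0 := Complex.ofReal_ne_zero.mpr hu.ne'
  have h := Complex.integral_cpow_mul_exp_neg_mul_Ioi (a := s) (r := 1 / u) hs (by positivity)
  have h' : ∀ Y : ℝ, (Y : ℂ) ^ (s - 1) * (besselKernel κ Y u : ℂ) =
      ((u ^ (κ - 1) * Real.exp (-u) : ℝ) : ℂ) *
        ((Y : ℂ) ^ (s - 1) * Complex.exp (-(((1 / u : ℝ) : ℂ) * Y))) := by
    intro Y
    rw [besselKernel]
    push_cast
    ring
  simp only [h', integral_const_mul]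
  rw [h, show (1 / ((1 / u : ℝ) : ℂ)) = u by push_cast; field_simp, Complex.ofReal_mul,
    Complex.ofReal_cpow hu.le, show s + κ - 1 = ((κ - 1 : ℝ) : ℂ) + s by push_cast; ring,
    Complex.cpow_add _ _ hu']
  push_cast
  ring

theorem norm_Gamma_le {s : ℂ} (hs : 0 < s.re) : ‖Complex.Gamma s‖ ≤ Real.Gamma s.re := by
  rw [Complex.Gamma_eq_integral hs, Complex.GammaIntegral, Real.Gamma_eq_integral hs]
  refine (norm_integral_le_integral_norm _).trans_eq ?_
  refine setIntegral_congr_fun measurableSet_Ioi fun u hu => ?_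
  simp only [norm_mul, Complex.norm_real, Real.norm_of_nonneg (Real.exp_nonneg _)]
  rw [Complex.norm_cpow_eq_rpow_re_of_pos hu]
  simp

/-- Quadratic decay suffices: `Γ(s) = Γ(s+2) / (s(s+1))`, with `Γ(s+2)` and `Γ(s+κ)` bounded on the
line. -/
theorem verticalIntegrable_Gamma_mul_Gamma_add {c κ : ℝ} (hc : 0 < c) (hκ : 0 ≤ κ) :
    Complex.VerticalIntegrable (fun s => Complex.Gamma s * Complex.Gamma (s + κ)) c := by
  have hcont : ∀ d : ℝ, 0 ≤ d →
      Continuous fun τ : ℝ => Complex.Gamma ((c : ℂ) + τ * Complex.I + d) := by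
    intro d hd
    refine continuous_iff_continuousAt.mpr fun τ => ?_
    refine ContinuousAt.comp (f := fun τ : ℝ => (c : ℂ) + τ * Complex.I + d)
      (Complex.differentiableAt_Gamma _ fun m h => ?_).continuousAt (by fun_prop)
    have := congrArg Complex.re h
    simp at this
    have hm : (0 : ℝ) ≤ m := m.cast_nonneg
    linarith
  -- The factor `max 1 (1 / c²)` serves to bound `1 + τ²` by a multiple of `|s|² = c² + τ²`.
  have hb : Integrable fun τ : ℝ =>
      Real.Gamma (c + 2) * Real.Gamma (c + κ) * (max 1 (1 / c ^ 2) * (1 + τ ^ 2)⁻¹) :=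
    (integrable_inv_one_add_sq.const_mul _).const_mul _
  have h0 := hcont 0 le_rfl
  simp only [Complex.ofReal_zero, add_zero] at h0
  refine hb.mono' (h0.mul (hcont κ hκ)).aestronglyMeasurable (Eventually.of_forall fun τ => ?_)
  set s : ℂ := (c : ℂ) + τ * Complex.I with hs
  have hre : s.re = c := by simp [hs]
  have him : s.im = τ := by simp [hs]
  have hs0 : s ≠ 0 := fun h => hc.ne' (by rw [← hre, h, Complex.zero_re])
  have hs1 : s + 1 ≠ 0 := fun h => by
    have := congrArg Complex.re h
    simp [hre] at this
    linarith
  have hrec : Complex.Gamma (s + 2) = (s + 1) * s * Complex.Gamma s := by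
    rw [show s + 2 = s + 1 + 1 by ring, Complex.Gamma_add_one _ hs1, Complex.Gamma_add_one _ hs0]
    ring
  have hG2 : ‖Complex.Gamma (s + 2)‖ ≤ Real.Gamma (c + 2) := by
    have := norm_Gamma_le (s := s + 2) (by simp [hre]; linarith)
    simpa [hre] using this
  have hGκ : ‖Complex.Gamma (s + κ)‖ ≤ Real.Gamma (c + κ) := by
    have := norm_Gamma_le (s := s + κ) (by simp [hre]; linarith)
    simpa [hre] using this
  have hss : ‖s‖ * ‖s‖ ≤ ‖s + 1‖ * ‖s‖ := by
    refine mul_le_mul_of_nonneg_right ?_ (norm_nonneg _)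
    rw [Complex.norm_def, Complex.norm_def]
    refine Real.sqrt_le_sqrt ?_
    simp only [Complex.normSq_apply, Complex.add_re, Complex.add_im, Complex.one_re,
      Complex.one_im, hre, him]
    nlinarith
  have hsq : ‖s‖ * ‖s‖ = c ^ 2 + τ ^ 2 := by
    rw [Complex.norm_mul_self_eq_normSq, Complex.normSq_apply, hre, him]
    ring
  have hm : 1 + τ ^ 2 ≤ max 1 (1 / c ^ 2) * (c ^ 2 + τ ^ 2) := by
    have h1 : 1 ≤ max 1 (1 / c ^ 2) * c ^ 2 := by
      calc 1 = 1 / c ^ 2 * c ^ 2 := by field_simp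
        _ ≤ _ := by gcongr; exact le_max_right _ _
    have h2 : 1 * τ ^ 2 ≤ max 1 (1 / c ^ 2) * τ ^ 2 := by gcongr; exact le_max_left _ _
    linarith
  have hGs : ‖Complex.Gamma s‖ ≤ Real.Gamma (c + 2) * (max 1 (1 / c ^ 2) * (1 + τ ^ 2)⁻¹) := by
    rw [hrec, norm_mul, norm_mul] at hG2
    have h3 : (1 + τ ^ 2) * ‖Complex.Gamma s‖ ≤ max 1 (1 / c ^ 2) * Real.Gamma (c + 2) :=
      calc (1 + τ ^ 2) * ‖Complex.Gamma s‖
          ≤ max 1 (1 / c ^ 2) * (‖s‖ * ‖s‖) * ‖Complex.Gamma s‖ := by rw [hsq]; gcongr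
        _ = max 1 (1 / c ^ 2) * (‖s‖ * ‖s‖ * ‖Complex.Gamma s‖) := by ring
        _ ≤ max 1 (1 / c ^ 2) * (‖s + 1‖ * ‖s‖ * ‖Complex.Gamma s‖) := by gcongr
        _ ≤ _ := by gcongr
    have hp : 0 < 1 + τ ^ 2 := by positivity
    rw [← mul_assoc, ← div_eq_mul_inv, le_div_iff₀ hp]
    linarith
  rw [norm_mul]
  have hpos := (Real.Gamma_pos_of_pos (show 0 < c + 2 by linarith)).le
  calc ‖Complex.Gamma s‖ * ‖Complex.Gamma (s + κ)‖
      ≤ (Real.Gamma (c + 2) * (max 1 (1 / c ^ 2) * (1 + τ ^ 2)⁻¹)) * Real.Gamma (c + κ) := by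
        gcongr
    _ = _ := by ring

/-- The substitution `u = √Y e^t` turns `u + Y/u` into `2√Y cosh t`; folding `t ↦ -t` turns `e^{κt}`
into `2 cosh(κt)`. -/
theorem integral_besselKernel_eq_besselK {κ Y : ℝ} (hκ : 0 ≤ κ) (hY : 0 < Y) :
    ∫ u in Ioi (0 : ℝ), besselKernel κ Y u =
      2 * Y ^ (κ / 2) * besselK κ (2 * Real.sqrt Y) := by
  set ℓ : ℝ := Real.log Y / 2 with hℓ
  set h : ℝ → ℝ := fun t => Real.exp (-(2 * Real.sqrt Y) * Real.cosh t) * Real.exp (κ * t) with hh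
  have hderiv : ∀ t ∈ univ, HasDerivWithinAt (fun t => Real.exp (t + ℓ)) (Real.exp (t + ℓ)) univ t :=
    fun t _ => by simpa using ((hasDerivAt_id t).add_const ℓ).exp
  have hinj : univ.InjOn fun t => Real.exp (t + ℓ) :=
    fun a _ b _ hab => by simpa using hab
  have himage : (fun t => Real.exp (t + ℓ)) '' univ = Ioi 0 := by
    ext u
    simp only [image_univ, mem_range, mem_Ioi]
    exact ⟨fun ⟨t, ht⟩ => ht ▸ Real.exp_pos _,
      fun hu => ⟨Real.log u - ℓ, by rw [sub_add_cancel, Real.exp_log hu]⟩⟩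
  have hsqrt : Real.sqrt Y = Real.exp ℓ := by
    rw [hℓ, Real.exp_half, Real.exp_log hY]
  have hYexp : Y = Real.exp ℓ * Real.exp ℓ := by
    rw [← hsqrt, Real.mul_self_sqrt hY.le]
  have hpow : Y ^ (κ / 2) = Real.exp (κ * ℓ) := by
    rw [Real.rpow_def_of_pos hY, hℓ]
    ring_nf
  have hsub : ∀ t : ℝ, |Real.exp (t + ℓ)| • besselKernel κ Y (Real.exp (t + ℓ)) =
      Y ^ (κ / 2) * h t := by
    intro t
    have e1 : -Real.exp (t + ℓ) + -(1 / Real.exp (t + ℓ) * Y) =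
        -(2 * Real.sqrt Y) * Real.cosh t := by
      rw [one_div, ← Real.exp_neg, hsqrt, Real.cosh_eq, neg_add, Real.exp_add, Real.exp_add]
      conv_lhs => rw [hYexp]
      rw [Real.exp_neg ℓ]
      field_simp
      ring
    rw [abs_of_pos (Real.exp_pos _), besselKernel, smul_eq_mul, hpow, mul_assoc _ (Real.exp _),
      ← Real.exp_add, e1, ← Real.exp_mul]
    simp only [hh, ← Real.exp_add]
    congr 1
    ring
  have hint : Integrable h := by
    have h1 := integrableOn_besselKernel hκ hY
    rw [← himage, integrableOn_image_iff_integrableOn_abs_deriv_smul MeasurableSet.univ hderiv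
      hinj] at h1
    simp only [hsub] at h1
    rw [integrableOn_univ] at h1
    exact (integrable_const_mul_iff (Real.rpow_pos_of_pos hY _).ne'.isUnit _).mp h1
  have hfold : ∫ t, h t = 2 * besselK κ (2 * Real.sqrt Y) := by
    have hneg : ∫ t in Ioi (0 : ℝ), h (-t) = ∫ t in Iic (0 : ℝ), h t := by
      simp
    rw [← integral_add_compl measurableSet_Iic hint, compl_Iic, ← hneg,
      ← integral_add (hint.comp_neg.integrableOn) hint.integrableOn, besselK, ← integral_const_mul]
    refine setIntegral_congr_fun measurableSet_Ioi fun t _ => ?_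
    simp only [hh, Real.cosh_neg, Real.cosh_eq (κ * t), mul_neg]
    ring
  rw [← himage, integral_image_eq_integral_abs_deriv_smul MeasurableSet.univ hderiv hinj]
  simp only [hsub, integral_const_mul, setIntegral_univ, hfold]
  ring

theorem integral_Gamma_mul_Gamma_add_mul_cpow {c κ Y : ℝ} (hc : 0 < c) (hκ : 0 ≤ κ)
    (hY : 0 < Y) :
    ∫ τ : ℝ, Complex.Gamma ((c : ℂ) + τ * Complex.I) *
        Complex.Gamma ((c : ℂ) + τ * Complex.I + κ) * (Y : ℂ) ^ (-((c : ℂ) + τ * Complex.I)) =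
      2 * Real.pi * ((2 * Y ^ (κ / 2) * besselK κ (2 * Real.sqrt Y) : ℝ) : ℂ) := by
  have hre : ∀ τ : ℝ, 0 < ((c : ℂ) + τ * Complex.I).re := fun τ => by simpa using hc
  have hvert : Complex.VerticalIntegrable
      (mellin fun Y => ((∫ u in Ioi (0 : ℝ), besselKernel κ Y u : ℝ) : ℂ)) c := by
    refine (verticalIntegrable_Gamma_mul_Gamma_add hc hκ).congr (Eventually.of_forall fun τ => ?_)
    exact (mellin_integral_besselKernel hκ (hre τ)).symm
  have hinv := mellinInv_mellin_eq c _ hY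
    (mellinConvergent_integral_besselKernel hκ (s := (c : ℂ)) (by simpa using hc)) hvert
    (Complex.continuous_ofReal.continuousAt.comp (continuousAt_integral_besselKernel hκ hY))
  rw [mellinInv] at hinv
  simp only [mellin_integral_besselKernel hκ (hre _), integral_besselKernel_eq_besselK hκ hY,
    smul_eq_mul] at hinv
  rw [← hinv, Complex.real_smul]
  push_cast
  have hpi : (Real.pi : ℂ) ≠ 0 := Complex.ofReal_ne_zero.mpr Real.pi_ne_zero
  field_simp
  exact integral_congr_ae (Eventually.of_forall fun τ => by ring_nf)

theorem integrable_Gamma_mul_Gamma_add_mul_cpow {c κ Y : ℝ} (hc : 0 < c) (hκ : 0 ≤ κ)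
    (hY : 0 < Y) :
    Integrable fun τ : ℝ => Complex.Gamma ((c : ℂ) + τ * Complex.I) *
        Complex.Gamma ((c : ℂ) + τ * Complex.I + κ) * (Y : ℂ) ^ (-((c : ℂ) + τ * Complex.I)) := by
  have hY' : (Y : ℂ) ≠ 0 := Complex.ofReal_ne_zero.mpr hY.ne'
  have hcont : Continuous fun τ : ℝ => (Y : ℂ) ^ (-((c : ℂ) + τ * Complex.I)) :=
    Continuous.const_cpow (by fun_prop) (Or.inl hY')
  refine (verticalIntegrable_Gamma_mul_Gamma_add hc hκ).mul_bdd (c := Y ^ (-c))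
    hcont.aestronglyMeasurable (Eventually.of_forall fun τ => ?_)
  rw [Complex.norm_cpow_eq_rpow_re_of_pos hY]
  simp

/-! ### Expansion of the integrand for `Q` -/

theorem ordinaryHypergeometric_neg_natCast (n : ℕ) (b d r : ℂ) :
    ordinaryHypergeometric (-(n : ℂ)) b d r = ∑ k ∈ Finset.range (n + 1),
      (n.choose k : ℂ) * ((-r) ^ k * (ascPochhammer ℂ k).eval b / (ascPochhammer ℂ k).eval d) := by
  rw [ordinaryHypergeometric_eq_tsum]
  simp only
  rw [tsum_eq_sum (s := Finset.range (n + 1))]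
  · refine Finset.sum_congr rfl fun k _ => ?_
    have f1 : (k.factorial : ℂ) ≠ 0 := by exact_mod_cast k.factorial_ne_zero
    rw [ascPochhammer_eval_neg_natCast, smul_eq_mul, neg_pow r]
    field_simp
  · intro k hk
    rw [ascPochhammer_eval_neg_coe_nat_of_lt (by simpa using hk)]
    simp

theorem integrandQ_eq_terminatingGaussSum (μ : ℝ) (ν n : ℕ) (y : ℝ) {s : ℂ}
    (hs : ∀ m : ℕ, s - n ≠ -m) :
    integrandQ μ ν n y s = Complex.Gamma s * Complex.Gamma (s + ν) *
      terminatingGaussSum n (ν + s) (s - n) ((δ μ ^ 2 / α μ ^ 2 : ℝ) : ℂ) *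
        ((α μ ^ 2 * y : ℝ) : ℂ) ^ (-s) := by
  have hG := Complex.Gamma_ne_zero hs
  have hquot := Complex.Gamma_add_nat_div_Gamma_eq (n := n) _ hs
  rw [sub_add_cancel] at hquot
  have hsum : (ascPochhammer ℂ n).eval (s - n) *
      ordinaryHypergeometric (-(n : ℂ)) ((ν : ℂ) + s) (s - n) ((δ μ ^ 2 / α μ ^ 2 : ℝ) : ℂ) =
      terminatingGaussSum n (ν + s) (s - n) ((δ μ ^ 2 / α μ ^ 2 : ℝ) : ℂ) := by
    rw [ordinaryHypergeometric_neg_natCast, terminatingGaussSum,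
      Finset.Nat.sum_antidiagonal_eq_sum_range_succ_mk, Finset.mul_sum]
    refine Finset.sum_congr rfl fun k hk => ?_
    have hsplit := ascPochhammer_add_eval k (n - k) (s - n)
    rw [Nat.add_sub_cancel' (Finset.mem_range_succ_iff.mp hk)] at hsplit
    have hne : (ascPochhammer ℂ k).eval (s - n) ≠ 0 := by
      rw [← Complex.Gamma_add_nat_div_Gamma_eq _ hs]
      refine div_ne_zero (Complex.Gamma_ne_zero fun m h => hs (m + k) ?_) hG
      push_cast
      linear_combination h
    rw [hsplit]
    field_simp
  rw [integrandQ, ← hsum, ← hquot]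
  field_simp

theorem Gamma_mul_terminatingGaussSum (ν n : ℕ) {s : ℂ} (hs : 0 < s.re) (r : ℂ) :
    Complex.Gamma (s + ν) * terminatingGaussSum n (ν + s) (s - n) r =
      ∑ l ∈ Finset.range (n + 1), (-1) ^ n * (-1) ^ l * n.choose l * (1 - r) ^ l *
        ((n + ν).factorial / (ν + l).factorial) * Complex.Gamma (s + (l + ν)) := by
  have hs' : ∀ m : ℕ, s + ν ≠ -m := fun m h => by
    have := congrArg Complex.re h
    simp at this
    have h1 : (0 : ℝ) ≤ m := m.cast_nonneg
    have h2 : (0 : ℝ) ≤ ν := ν.cast_nonneg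
    linarith
  have hG := Complex.Gamma_ne_zero hs'
  -- With `b = ν + s`, the choice `d = ν + 1` makes `b - d - n + 1` equal to `s - n`, and the
  -- factors `(d + l)_{n-l}` become free of `s`.
  have h := terminatingGaussSum_one_sub n (ν + s) (ν + 1) r
  rw [show (ν : ℂ) + s - (ν + 1) - n + 1 = s - n by ring] at h
  rw [h, terminatingGaussSum, Finset.Nat.sum_antidiagonal_eq_sum_range_succ_mk, Finset.mul_sum,
    Finset.mul_sum]
  refine Finset.sum_congr rfl fun l hl => ?_
  have hl' := Finset.mem_range_succ_iff.mp hl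
  have h1 := ascPochhammer_eval_natCast_add_one (ν + l) (n - l)
  rw [show ν + l + (n - l) = n + ν by omega] at h1
  push_cast at h1
  have h2 := Complex.Gamma_add_nat_div_Gamma_eq (n := l) _ hs'
  rw [show s + ν + (l : ℂ) = s + (l + ν) by ring] at h2
  rw [show (ν : ℂ) + 1 + l = ν + l + 1 by ring, h1, add_comm (ν : ℂ) s, ← h2, neg_pow (1 - r)]
  field_simp

theorem integrandQ_eq_sum (μ : ℝ) (ν n : ℕ) (y : ℝ) {c : ℝ} (hc : 0 < c) {τ : ℝ} (hτ : τ ≠ 0) :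
    integrandQ μ ν n y ((c : ℂ) + τ * Complex.I) =
      ∑ l ∈ Finset.range (n + 1), (-1) ^ n * (-1) ^ l * n.choose l *
        (1 - ((δ μ ^ 2 / α μ ^ 2 : ℝ) : ℂ)) ^ l * ((n + ν).factorial / (ν + l).factorial) *
        (Complex.Gamma ((c : ℂ) + τ * Complex.I) *
          Complex.Gamma ((c : ℂ) + τ * Complex.I + ((l + ν : ℝ) : ℂ)) *
          ((α μ ^ 2 * y : ℝ) : ℂ) ^ (-((c : ℂ) + τ * Complex.I))) := by
  rw [integrandQ_eq_terminatingGaussSum, mul_assoc (Complex.Gamma _),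
    Gamma_mul_terminatingGaussSum ν n (by simpa using hc), Finset.mul_sum, Finset.sum_mul]
  · refine Finset.sum_congr rfl fun l _ => ?_
    push_cast
    ring
  · intro m h
    have := congrArg Complex.im h
    simp at this
    exact hτ this

theorem verticalIntegrable_and_verticalIntegral_integrandQ {μ : ℝ} (hμ : 0 < μ) (ν n : ℕ) {y c : ℝ} (hy : 0 < y)
    (hc : 0 < c) :
    Complex.VerticalIntegrable (integrandQ μ ν n y) c ∧
      verticalIntegral c (integrandQ μ ν n y) = 2 * Real.pi * Complex.I *
        ∑ l ∈ Finset.range (n + 1), (-1) ^ n * (-1) ^ l * n.choose l *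
          (1 - ((δ μ ^ 2 / α μ ^ 2 : ℝ) : ℂ)) ^ l * ((n + ν).factorial / (ν + l).factorial) *
          ((2 * (α μ ^ 2 * y) ^ (((l : ℝ) + ν) / 2) *
            besselK ((l : ℝ) + ν) (2 * Real.sqrt (α μ ^ 2 * y)) : ℝ) : ℂ) := by
  have hα : 0 < α μ := div_pos (by linarith) (by linarith)
  have hY : 0 < α μ ^ 2 * y := by positivity
  -- If `c` is an integer at most `n`, the line meets a pole of `Γ(s - n)`, but only at `τ = 0`.
  have hae : ∀ᵐ τ : ℝ, τ ≠ 0 := by simp [ae_iff, measure_singleton]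
  have hint : ∀ l ∈ Finset.range (n + 1), Integrable fun τ : ℝ =>
      (-1) ^ n * (-1) ^ l * n.choose l *
        (1 - ((δ μ ^ 2 / α μ ^ 2 : ℝ) : ℂ)) ^ l * ((n + ν).factorial / (ν + l).factorial) *
        (Complex.Gamma ((c : ℂ) + τ * Complex.I) *
          Complex.Gamma ((c : ℂ) + τ * Complex.I + ((l + ν : ℝ) : ℂ)) *
          ((α μ ^ 2 * y : ℝ) : ℂ) ^ (-((c : ℂ) + τ * Complex.I))) := fun l _ =>
    (integrable_Gamma_mul_Gamma_add_mul_cpow hc (by positivity) hY).const_mul _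
  have hcongr := hae.mono fun τ hτ => integrandQ_eq_sum μ ν n y hc hτ
  constructor
  · exact (integrable_finsetSum _ hint).congr (hcongr.mono fun τ h => h.symm)
  · rw [verticalIntegral, integral_congr_ae hcongr, integral_finsetSum _ hint, Finset.mul_sum,
      Finset.mul_sum]
    refine Finset.sum_congr rfl fun l _ => ?_
    rw [integral_const_mul, integral_Gamma_mul_Gamma_add_mul_cpow hc (by positivity) hY]
    ring

/-- Writing `α² - δ² = α² w` with `w = 1 - δ²/α²`, the power `l + ν` yields `w^ν` for the prefactor,
`w^l` for the transformed Gauss sum, and `α^{2(l+ν)}`; half of the latter cancels the denominator,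
half completes `y^{(l+ν)/2}` to `(α²y)^{(l+ν)/2}`. -/
theorem Q_eq_sum {μ : ℝ} (hμ : 0 < μ) (ν n : ℕ) {y : ℝ} (hy : 0 < y) :
    (Q μ ν n y : ℂ) =
      1 / ((n.factorial : ℂ) ^ 2 * ((n + ν).factorial : ℂ)) *
        (((1 - δ μ ^ 2 / α μ ^ 2) ^ ν : ℝ) : ℂ) *
        (((α μ ^ 2 - δ μ ^ 2) ^ (1 / 2 : ℝ) : ℝ) : ℂ) *
        ∑ l ∈ Finset.range (n + 1), (-1) ^ n * (-1) ^ l * n.choose l *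
          (1 - ((δ μ ^ 2 / α μ ^ 2 : ℝ) : ℂ)) ^ l * ((n + ν).factorial / (ν + l).factorial) *
          ((2 * (α μ ^ 2 * y) ^ (((l : ℝ) + ν) / 2) *
            besselK ((l : ℝ) + ν) (2 * Real.sqrt (α μ ^ 2 * y)) : ℝ) : ℂ) := by
  have hα : 0 < α μ := div_pos (by linarith) (by linarith)
  have hA : 0 < α μ ^ 2 - δ μ ^ 2 := by
    rw [α_sq_sub_δ_sq hμ]
    positivity
  suffices hreal : Q μ ν n y =
      1 / ((n.factorial : ℝ) ^ 2 * ((n + ν).factorial : ℝ)) * (1 - δ μ ^ 2 / α μ ^ 2) ^ ν *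
        (α μ ^ 2 - δ μ ^ 2) ^ (1 / 2 : ℝ) *
        ∑ l ∈ Finset.range (n + 1), (-1) ^ n * (-1) ^ l * n.choose l *
          (1 - δ μ ^ 2 / α μ ^ 2) ^ l * ((n + ν).factorial / (ν + l).factorial) *
          (2 * (α μ ^ 2 * y) ^ (((l : ℝ) + ν) / 2) *
            besselK ((l : ℝ) + ν) (2 * Real.sqrt (α μ ^ 2 * y))) by
    rw [hreal]
    push_cast
    rfl
  rw [Q, Finset.mul_sum, Finset.mul_sum]
  refine Finset.sum_congr rfl fun l _ => ?_
  have hsqrt : 2 * Real.sqrt (α μ ^ 2 * y) = 2 * α μ * Real.sqrt y := by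
    rw [Real.sqrt_mul (by positivity), Real.sqrt_sq hα.le]
    ring
  have hpow : (α μ ^ 2 * y) ^ (((l : ℝ) + ν) / 2) = α μ ^ (l + ν) * y ^ (((l : ℝ) + ν) / 2) := by
    rw [Real.mul_rpow (by positivity) hy.le, ← Real.rpow_natCast (α μ) 2, ← Real.rpow_mul hα.le,
      ← Real.rpow_natCast (α μ) (l + ν)]
    push_cast
    ring_nf
  have hApow : (α μ ^ 2 - δ μ ^ 2) ^ ((l : ℝ) + ν + 1 / 2) =
      (α μ ^ 2) ^ (l + ν) * (1 - δ μ ^ 2 / α μ ^ 2) ^ (l + ν) *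
        (α μ ^ 2 - δ μ ^ 2) ^ (1 / 2 : ℝ) := by
    rw [Real.rpow_add hA, show (l : ℝ) + ν = ((l + ν : ℕ) : ℝ) by push_cast; rfl,
      Real.rpow_natCast, ← mul_pow]
    congr 2
    field_simp
  have f1 : (n.factorial : ℝ) ≠ 0 := by exact_mod_cast n.factorial_ne_zero
  have f2 : ((n + ν).factorial : ℝ) ≠ 0 := by exact_mod_cast (n + ν).factorial_ne_zero
  have f3 : ((ν + l).factorial : ℝ) ≠ 0 := by exact_mod_cast (ν + l).factorial_ne_zero
  have f4 : (l.factorial : ℝ) ≠ 0 := by exact_mod_cast l.factorial_ne_zero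
  rw [ascPochhammer_eval_neg_natCast, hsqrt, hpow, hApow]
  generalize 1 - δ μ ^ 2 / α μ ^ 2 = w
  field_simp
  ring

theorem mainTheorem7 (μ : ℝ) (hμ0 : 0 < μ) (hμ1 : μ < 1) (ν n : ℕ) :
    (∀ (x : ℝ), 0 < x → ∀ (a : ℂ) (γ : Path a a), EncirclesOnce γ n →
      CurveIntegrable (formDz (integrandP μ ν n x)) γ ∧
      (P μ ν n x : ℂ) =
        1 / (2 * Real.pi * Complex.I) * ((ν + n).factorial : ℂ) * (n.factorial : ℂ) ^ 2 *
          (((α μ ^ 2 - δ μ ^ 2) ^ (1 / 2 : ℝ) : ℝ) : ℂ) *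
          contourIntegral γ (integrandP μ ν n x)) ∧
    (∀ (y : ℝ), 0 < y → ∀ (c : ℝ), 0 < c →
      Complex.VerticalIntegrable (integrandQ μ ν n y) c ∧
      (Q μ ν n y : ℂ) =
        1 / (2 * Real.pi * Complex.I * (n.factorial : ℂ) ^ 2 * ((n + ν).factorial : ℂ)) *
          (((1 - δ μ ^ 2 / α μ ^ 2) ^ ν : ℝ) : ℂ) *
          (((α μ ^ 2 - δ μ ^ 2) ^ (1 / 2 : ℝ) : ℝ) : ℂ) *
          verticalIntegral c (integrandQ μ ν n y)) := by
  have hpi := Complex.two_pi_I_ne_zero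
  refine ⟨fun x hx a γ hγ => ?_, fun y hy c hc => ?_⟩
  · obtain ⟨hint, hval⟩ := curveIntegrable_and_contourIntegral_integrandP hμ0 ν n hx hγ
    refine ⟨hint, ?_⟩
    rw [P_eq_sum_entireFactorP hμ0 hμ1 ν n hx, hval]
    generalize 2 * (Real.pi : ℂ) * Complex.I = p at hpi ⊢
    field_simp
  · obtain ⟨hint, hval⟩ := verticalIntegrable_and_verticalIntegral_integrandQ hμ0 ν n hy hc
    refine ⟨hint, ?_⟩
    rw [Q_eq_sum hμ0 ν n hy, hval]
    generalize 2 * (Real.pi : ℂ) * Complex.I = p at hpi ⊢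
    field_simp
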